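/- Let $\Omega$ be a ground set and let $f$ be a nonnegative, monotone, submodular real function on the finite subsets of $\Omega$; write $f(u\mid T)=f(T\cup\{u\})-f(T)$. Distinct elements of $\Omega$ arrive one by one in a finite sequence of unknown length. A deterministic online algorithm with free disposal for the $k$-uniform matroid maintains a set $S$ with $|S|\le k$, initially empty; when an element $u$ arrives it may remove elements from $S$ and may add $u$, and its decisions may depend only on the arrivals so far and on the values of $f$ on sets of arrived elements. It has competitive ratio $r$ if, for every such $f$ and every sequence, its final set satisfies $f(S)\ge r\cdot f(\mathrm{OPT})$, where $\mathrm{OPT}$ maximizes $f$ among the sets of at most $k$ arrived elements. It is strictly monotone if, in every round, it includes the arriving element only if $f(S)$ strictly increases compared to the beginning of the round. **Constants.** For every integer $k\ge 2$ the equation $a=\bigl(1+\frac{a-2}{k+1}\bigr)^{k+1}$ has exactly one root $\alpha_k$ in the interval $(3,4)$. The equation $a=e^{a-2}$ has exactly one root $\alpha_\infty>1$, and $|\alpha_\infty-3.14619|<5\cdot 10^{-6}$. The sequence $(\alpha_k)_{k\ge2}$ is strictly decreasing and tends to $\alpha_\infty$ as $k\to\infty$. **Algorithm 1** (for $k\ge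 4$). Start with $S=A=\varnothing$. For an accepted element $v$, let $A(v)$ be the set of elements accepted before $v$, and put $w(v)=f(v\mid A(v))$ and $w_S(v)=f(v\mid A(v)\cap S)$; for the arriving element $u$ put $w(u)=f(u\mid A)$. When $u$ arrives, accept it if and only if $$w(u)>\frac1k\Bigl(\alpha_k\sum_{v\in S}w_S(v)-\sum_{v\in A}w(v)\Bigr).$$ If $u$ is accepted and $|S|=k$, first remove from $S$ an element minimizing $w_S$ over $S$ (ties broken arbitrarily); then add $u$ to $S$ and to $A$. **Theorem.** For every $k\ge4$, Algorithm 1 is strictly monotone and has competitive ratio $1/\alpha_k$, however ties are broken. **Corollary.** For every $k\ge1$, the algorithm that starts with $\varnothing$ and replaces its set $S$ by the arriving singleton $\{u\}$ exactly when $f(\{u\})>f(S)$ has competitive ratio $1/k$. Let $r_1=1$ and $r_k=\max\{1/k,1/\alpha_k\}$ for $k\ge2$. Using this algorithm for $k\le3$ and Algorithm 1 for $k\ge4$ gives, for every $k\ge1$, a deterministic algorithm for the $k$-uniform matroid with competitive ratio $r_k$. Moreover $\min_{k\ge1}r_k=1/\alpha_4>0.2959$; in particular, for every $k\ge1$ there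 is a deterministic algorithm for the $k$-uniform matroid with competitive ratio $1/\alpha_4$. -/

import Mathlib

namespace OnlineSubmod

/-! ### The constants `α_k` and `α_∞` -/

/-- `a` is a root in `(3,4)` of the equation `a = (1 + (a - 2)/(k + 1))^(k + 1)`. -/
def IsAlphaRoot (k : ℕ) (a : ℝ) : Prop :=
  3 < a ∧ a < 4 ∧ a = (1 + (a - 2) / ((k : ℝ) + 1)) ^ (k + 1)

/-- `α_k`: the root of `IsAlphaRoot k` (which is unique for `k ≥ 2`). -/
noncomputable def alphaK (k : ℕ) : ℝ := sSup {a : ℝ | IsAlphaRoot k a}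

/-- `a` is a root greater than `1` of the equation `a = exp (a - 2)`. -/
def IsAlphaInfRoot (a : ℝ) : Prop := 1 < a ∧ a = Real.exp (a - 2)

/-- `α_∞`: the (unique) root of `IsAlphaInfRoot`. -/
noncomputable def alphaInf : ℝ := sSup {a : ℝ | IsAlphaInfRoot a}

/-- The ratio `max {1/k, 1/α_k}` for `k ≥ 2`. For `k = 1` the equation has no root in `(3,4)`,
and the ratio is `1/k = 1`. -/
noncomputable def uniformRatio (k : ℕ) : ℝ :=
  if k = 1 then 1 else max (1 / (k : ℝ)) (1 / alphaK k)

/-! ### Set functions, feasible sets, online algorithms with free disposal -/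

section Model

variable {Ω : Type*} [DecidableEq Ω]

/-- Nonnegative monotone submodular set functions (on the finite subsets of the ground set). -/
structure IsMonoSubmodular (f : Finset Ω → ℝ) : Prop where
  nonneg : ∀ S, 0 ≤ f S
  mono : ∀ S T, S ⊆ T → f S ≤ f T
  submodular : ∀ S T, f (S ∪ T) + f (S ∩ T) ≤ f S + f T

/-- Independence in the `k`-uniform matroid. -/
def UniformIndep (Ω : Type*) (k : ℕ) (S : Finset Ω) : Prop := S.card ≤ k

/-- A deterministic online algorithm with free disposal for the constraint `I`, with value oracle
access to the objective. A history is the list of the elements that have arrived so far,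
*most recent first*, and `sol f l` is the set held by the algorithm after the history `l`.
* The algorithm starts with the empty set;
* in the round of `u` it may drop elements of its current set and may include `u`;
* the set is always feasible;
* what it holds after the history `l` depends only on `l` and on the values of `f` on sets of
  elements that have arrived. -/
structure OnlineAlgorithm (Ω : Type*) [DecidableEq Ω] (I : Finset Ω → Prop) where
  sol : (Finset Ω → ℝ) → List Ω → Finset Ω
  sol_nil : ∀ f, sol f [] = ∅
  sol_cons : ∀ f u l, sol f (u :: l) ⊆ insert u (sol f l)
  feasible : ∀ f l, I (sol f l)
  online : ∀ (f g : Finset Ω → ℝ) (l : List Ω),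
    (∀ T : Finset Ω, T ⊆ l.toFinset → f T = g T) → sol f l = sol g l

/-- `T` is an optimal solution for the arrived elements `l`. -/
def IsOPT (I : Finset Ω → Prop) (f : Finset Ω → ℝ) (l : List Ω) (T : Finset Ω) : Prop :=
  T ⊆ l.toFinset ∧ I T ∧ ∀ T' : Finset Ω, T' ⊆ l.toFinset → I T' → f T' ≤ f T

/-- The algorithm has competitive ratio `r` for nonnegative monotone submodular objectives, over
all finite sequences of distinct elements. -/
def OnlineAlgorithm.IsCompetitive {I : Finset Ω → Prop} (alg : OnlineAlgorithm Ω I) (r : ℝ) :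
    Prop :=
  ∀ f : Finset Ω → ℝ, IsMonoSubmodular f → ∀ l : List Ω, l.Nodup →
    ∀ T : Finset Ω, IsOPT I f l T → r * f T ≤ f (alg.sol f l)

/-- Strict monotonicity: in each round, the arriving element is included only if the objective
value strictly increases compared to the beginning of the round. -/
def OnlineAlgorithm.IsStrictlyMonotone {I : Finset Ω → Prop} (alg : OnlineAlgorithm Ω I) : Prop :=
  ∀ f : Finset Ω → ℝ, IsMonoSubmodular f → ∀ (u : Ω) (l : List Ω), (u :: l).Nodup →
    u ∈ alg.sol f (u :: l) → f (alg.sol f l) < f (alg.sol f (u :: l))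

/-! ### The threshold algorithm for the `k`-uniform matroid -/

/-- The marginal value `f(u | T) = f(T + u) - f(T)`. -/
def marginal (f : Finset Ω → ℝ) (u : Ω) (T : Finset Ω) : ℝ := f (insert u T) - f T

/-- A rule that breaks ties in `argmin`: given the history (including the arriving element) and
the nonempty set of minimizers, it picks one of them. -/
def TieBreak (Ω : Type*) : Type _ := List Ω → (M : Finset Ω) → M.Nonempty → {v : Ω // v ∈ M}

/-- The current set `S`, and the list of all elements ever accepted, most recent first. -/
structure State (Ω : Type*) where
  S : Finset Ω
  accepted : List Ω

/-- The set `A`. -/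
def State.A (s : State Ω) : Finset Ω := s.accepted.toFinset

/-- The elements that are listed after `u` (none if `u` is not listed). -/
def listedAfter (u : Ω) : List Ω → Finset Ω
  | [] => ∅
  | v :: l => if u = v then l.toFinset else listedAfter u l

/-- For an accepted element `u`: the set `A(u)` of the elements accepted before `u`. -/
def State.before (s : State Ω) (u : Ω) : Finset Ω := listedAfter u s.accepted

/-- `w(u) = f(u | A(u))` for an accepted element `u`. -/
def State.w (f : Finset Ω → ℝ) (s : State Ω) (u : Ω) : ℝ := marginal f u (s.before u)

/-- `w_S(u) = f(u | A(u) ∩ S)` for an accepted element `u`. -/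
def State.wS (f : Finset Ω → ℝ) (s : State Ω) (u : Ω) : ℝ := marginal f u (s.before u ∩ s.S)

/-- The acceptance condition `w(u) > (1/k) (α w_S(S) - w(A))` for an arriving element `u`, for
which `A(u) = A`. -/
def State.Accepts (f : Finset Ω → ℝ) (k : ℕ) (α : ℝ) (s : State Ω) (u : Ω) : Prop :=
  marginal f u s.A > 1 / (k : ℝ) * (α * ∑ v ∈ s.S, s.wS f v - ∑ v ∈ s.A, s.w f v)

open Classical in
/-- The elements of `S` that minimize `w_S`. -/
noncomputable def State.minimizers (f : Finset Ω → ℝ) (s : State Ω) : Finset Ω :=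
  s.S.filter fun v => ∀ x ∈ s.S, s.wS f v ≤ s.wS f x

/-- Remove from `S` the element of `M` picked by the tie-breaking rule. -/
def removePicked (tb : TieBreak Ω) (h : List Ω) (M S : Finset Ω) : Finset Ω :=
  if hM : M.Nonempty then S.erase (tb h M hM).1 else S

open Classical in
/-- One round of the algorithm, in which `u` arrives after the history `l`. -/
noncomputable def State.step (f : Finset Ω → ℝ) (k : ℕ) (α : ℝ) (tb : TieBreak Ω) (u : Ω)
    (l : List Ω) (s : State Ω) : State Ω :=
  if s.Accepts f k α u then
    { S := insert u
        (if s.S.card = k then removePicked tb (u :: l) (s.minimizers f) s.S else s.S)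
      accepted := u :: s.accepted }
  else s

/-- The state of the algorithm after a history (most recent arrival first). -/
noncomputable def thresholdRun (f : Finset Ω → ℝ) (k : ℕ) (α : ℝ) (tb : TieBreak Ω) :
    List Ω → State Ω
  | [] => { S := ∅, accepted := [] }
  | u :: l => (thresholdRun f k α tb l).step f k α tb u l

theorem removePicked_subset (tb : TieBreak Ω) (h : List Ω) (M S : Finset Ω) :
    removePicked tb h M S ⊆ S := by
  unfold removePicked
  split_ifs
  · exact Finset.erase_subset _ _
  · exact Finset.Subset.refl _

theorem State.minimizers_subset (f : Finset Ω → ℝ) (s : State Ω) : s.minimizers f ⊆ s.S :=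
  Finset.filter_subset _ _

theorem State.minimizers_nonempty (f : Finset Ω → ℝ) (s : State Ω) (h : s.S.Nonempty) :
    (s.minimizers f).Nonempty := by
  obtain ⟨v, hv, hmin⟩ := Finset.exists_min_image s.S (s.wS f) h
  exact ⟨v, Finset.mem_filter.2 ⟨hv, hmin⟩⟩

theorem State.step_subset (f : Finset Ω → ℝ) (k : ℕ) (α : ℝ) (tb : TieBreak Ω) (u : Ω)
    (l : List Ω) (s : State Ω) : (s.step f k α tb u l).S ⊆ insert u s.S := by
  unfold State.step
  split_ifs
  · exact Finset.insert_subset_insert _ (removePicked_subset _ _ _ _)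
  · exact Finset.Subset.refl _
  · exact Finset.subset_insert _ _

theorem State.step_card (f : Finset Ω → ℝ) (k : ℕ) (hk : 1 ≤ k) (α : ℝ) (tb : TieBreak Ω) (u : Ω)
    (l : List Ω) (s : State Ω) (hs : s.S.card ≤ k) : (s.step f k α tb u l).S.card ≤ k := by
  unfold State.step
  split_ifs with h1 h2
  · have hne : (s.minimizers f).Nonempty :=
      s.minimizers_nonempty f (Finset.card_pos.1 (by omega))
    have hmem := s.minimizers_subset f (tb (u :: l) _ hne).2
    have h3 := Finset.card_erase_of_mem hmem
    have h4 := Finset.card_insert_le u (s.S.erase (tb (u :: l) _ hne).1)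
    simp only [removePicked, dif_pos hne]
    omega
  · have h4 := Finset.card_insert_le u s.S
    show (insert u s.S).card ≤ k
    omega
  · exact hs

theorem thresholdRun_card (f : Finset Ω → ℝ) (k : ℕ) (hk : 1 ≤ k) (α : ℝ) (tb : TieBreak Ω)
    (l : List Ω) : (thresholdRun f k α tb l).S.card ≤ k := by
  induction l with
  | nil => simp [thresholdRun]
  | cons u l ih => exact State.step_card f k hk α tb u l _ ih

theorem thresholdRun_subset (f : Finset Ω → ℝ) (k : ℕ) (α : ℝ) (tb : TieBreak Ω)
    (l : List Ω) : (thresholdRun f k α tb l).S ⊆ l.toFinset ∧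
      (thresholdRun f k α tb l).A ⊆ l.toFinset := by
  induction l with
  | nil => simp [thresholdRun, State.A]
  | cons u l ih =>
    rw [List.toFinset_cons]
    refine ⟨(State.step_subset f k α tb u l _).trans (Finset.insert_subset_insert _ ih.1), ?_⟩
    simp only [thresholdRun, State.step]
    split_ifs
    · simpa [State.A] using Finset.insert_subset_insert u ih.2
    · simpa [State.A] using Finset.insert_subset_insert u ih.2
    · exact ih.2.trans (Finset.subset_insert _ _)

theorem listedAfter_subset (u : Ω) (l : List Ω) : listedAfter u l ⊆ l.toFinset := by
  induction l with
  | nil => simp [listedAfter]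
  | cons v l ih =>
    rw [listedAfter, List.toFinset_cons]
    split_ifs
    · exact Finset.subset_insert _ _
    · exact ih.trans (Finset.subset_insert _ _)

theorem marginal_congr {f g : Finset Ω → ℝ} {L : Finset Ω} (h : ∀ T, T ⊆ L → f T = g T)
    {u : Ω} {T : Finset Ω} (hu : u ∈ L) (hT : T ⊆ L) : marginal f u T = marginal g u T := by
  unfold marginal
  rw [h _ hT, h _ (Finset.insert_subset hu hT)]

theorem State.step_congr {f g : Finset Ω → ℝ} {L : Finset Ω} (h : ∀ T, T ⊆ L → f T = g T)
    (k : ℕ) (α : ℝ) (tb : TieBreak Ω) (u : Ω) (l : List Ω) (s : State Ω) (hu : u ∈ L)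
    (hS : s.S ⊆ L) (hA : s.A ⊆ L) : s.step f k α tb u l = s.step g k α tb u l := by
  have hb : ∀ v, s.before v ⊆ L := fun v => (listedAfter_subset v s.accepted).trans hA
  have hwS : ∀ v ∈ s.S, s.wS f v = s.wS g v := fun v hv =>
    marginal_congr h (hS hv) (Finset.inter_subset_left.trans (hb v))
  have hw : ∀ v ∈ s.A, s.w f v = s.w g v := fun v hv => marginal_congr h (hA hv) (hb v)
  have hM : s.minimizers f = s.minimizers g := by
    unfold State.minimizers
    refine Finset.filter_congr fun v hv => forall₂_congr fun x hx => ?_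
    rw [hwS v hv, hwS x hx]
  have hacc : s.Accepts f k α u = s.Accepts g k α u := by
    unfold State.Accepts
    rw [marginal_congr h hu hA, Finset.sum_congr rfl hwS, Finset.sum_congr rfl hw]
  unfold State.step
  rw [hM]
  by_cases h1 : s.Accepts g k α u
  · rw [if_pos h1, if_pos (hacc.mpr h1)]
  · rw [if_neg h1, if_neg fun h2 => h1 (hacc.mp h2)]

theorem thresholdRun_congr (f g : Finset Ω → ℝ) (k : ℕ) (α : ℝ) (tb : TieBreak Ω) (l : List Ω)
    (h : ∀ T : Finset Ω, T ⊆ l.toFinset → f T = g T) :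
    thresholdRun f k α tb l = thresholdRun g k α tb l := by
  induction l with
  | nil => rfl
  | cons u l ih =>
    have hl : l.toFinset ⊆ (u :: l).toFinset := by
      rw [List.toFinset_cons]
      exact Finset.subset_insert _ _
    have hs := thresholdRun_subset g k α tb l
    simp only [thresholdRun]
    rw [ih fun T hT => h T (hT.trans hl)]
    exact State.step_congr h k α tb u l _ (by simp) (hs.1.trans hl) (hs.2.trans hl)

/-- The threshold algorithm for the `k`-uniform matroid, with `α = α_k`. -/
noncomputable def thresholdAlg (k : ℕ) (hk : 4 ≤ k) (tb : TieBreak Ω) :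
    OnlineAlgorithm Ω (UniformIndep Ω k) where
  sol f l := (thresholdRun f k (alphaK k) tb l).S
  sol_nil _ := rfl
  sol_cons f u l := State.step_subset f k (alphaK k) tb u l _
  feasible f l := thresholdRun_card f k (by omega) (alphaK k) tb l
  online f g l h := by rw [thresholdRun_congr f g k (alphaK k) tb l h]

/-! ### Keeping the best singleton -/

open Classical in
/-- The current set is replaced by the arriving singleton if the latter is strictly better. -/
noncomputable def singletonRun (f : Finset Ω → ℝ) : List Ω → Finset Ω
  | [] => ∅
  | u :: l => if f (singletonRun f l) < f {u} then {u} else singletonRun f l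

theorem singletonRun_subset (f : Finset Ω → ℝ) (l : List Ω) :
    singletonRun f l ⊆ l.toFinset := by
  induction l with
  | nil => simp [singletonRun]
  | cons u l ih =>
    rw [singletonRun, List.toFinset_cons]
    split_ifs
    · simp
    · exact ih.trans (Finset.subset_insert _ _)

theorem singletonRun_congr (f g : Finset Ω → ℝ) (l : List Ω)
    (h : ∀ T : Finset Ω, T ⊆ l.toFinset → f T = g T) : singletonRun f l = singletonRun g l := by
  induction l with
  | nil => rfl
  | cons u l ih =>
    have hl : l.toFinset ⊆ (u :: l).toFinset := by
      rw [List.toFinset_cons]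
      exact Finset.subset_insert _ _
    simp only [singletonRun]
    rw [ih fun T hT => h T (hT.trans hl), h _ ((singletonRun_subset g l).trans hl),
      h {u} (by simp)]

/-- The algorithm that keeps the best singleton, for the `k`-uniform matroid. -/
noncomputable def singletonAlg (k : ℕ) (hk : 1 ≤ k) : OnlineAlgorithm Ω (UniformIndep Ω k) where
  sol f l := singletonRun f l
  sol_nil _ := rfl
  sol_cons f u l := by
    rw [singletonRun]
    split_ifs
    · simp
    · exact Finset.subset_insert _ _
  feasible f l := by
    have h : (singletonRun f l).card ≤ 1 := by
      induction l with
      | nil => simp [singletonRun]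
      | cons u l ih =>
        rw [singletonRun]
        split_ifs
        · simp
        · exact ih
    exact h.trans hk
  online f g l h := singletonRun_congr f g l h

/-- The combined algorithm: the threshold algorithm for `k ≥ 4`, the best singleton for
`k ≤ 3`. -/
noncomputable def combinedAlg (k : ℕ) (hk : 1 ≤ k) (tb : TieBreak Ω) :
    OnlineAlgorithm Ω (UniformIndep Ω k) :=
  if h : 4 ≤ k then thresholdAlg k h tb else singletonAlg k hk

end Model

end OnlineSubmod

/-! Write α = α_k and q = 1 + (α - 2)/(k + 1), so that α = q^(k+1). The weights telescope, so an
arriving u is accepted iff k f(u | A) exceeds the slack θ = α(f(S) - f(∅)) - (f(A) - f(∅)). A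
rejected u has f(u | A) ≤ θ/k. If θ never decreases, this persists, since marginals over the growing
A only fall. At the end every T with |T| ≤ k then satisfies f(T) ≤ f(A) + θ ≤ α f(S).

It remains to see that an exchange costs little: with m the smallest w_S and x = f(u | A), one needs
αm ≤ (α - 1)x. Acceptance gives x > θ/k, so θ must be large compared with m. This follows from the
invariant Φ ≤ θ (`State.SlackBound`), where Φ gives weight q^j to w_S of the j-th most recent
element of S; a full S has Φ ≥ m(q + ... + q^k).

The invariant survives because Φ and θ move in step. Deleting the minimizer lowers Φ by at least q^k
m (`geomSum_erase_add_le`), and the arrival of u multiplies what is left by q, so the saving is αm,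
exactly the loss in θ. A total rise D of the other w_S costs Φ at most αD (`geomSum_le_add`) and
earns θ exactly αD. What is left is an inequality between θ, x and f(u | S'), where S' is S after
the removal; it holds by the equation for α. `State.SlackBound.accept` carries this out.

The constants are handled by convexity: a convex function that is negative at the left end of its
domain crosses zero at most once. -/

namespace OnlineSubmod

/-! ### Marginals of submodular functions -/

section Submodular

variable {Ω : Type*} [DecidableEq Ω] {f : Finset Ω → ℝ}

theorem IsMonoSubmodular.marginal_nonneg (hf : IsMonoSubmodular f) (u : Ω) (T : Finset Ω) :
    0 ≤ marginal f u T :=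
  sub_nonneg.2 (hf.mono _ _ (Finset.subset_insert _ _))

theorem IsMonoSubmodular.marginal_anti (hf : IsMonoSubmodular f) {u : Ω} {S T : Finset Ω}
    (hST : S ⊆ T) : marginal f u T ≤ marginal f u S := by
  by_cases hu : u ∈ T
  · have h : marginal f u T = 0 := by simp [marginal, Finset.insert_eq_of_mem hu]
    rw [h]
    exact hf.marginal_nonneg u S
  · have h := hf.submodular (insert u S) T
    rw [Finset.insert_union, Finset.union_eq_right.2 hST, Finset.insert_inter_of_notMem hu,
      Finset.inter_eq_left.2 hST] at h
    unfold marginal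
    linarith

theorem IsMonoSubmodular.union_le_add_sum_marginal (hf : IsMonoSubmodular f) (A T : Finset Ω) :
    f (A ∪ T) ≤ f A + ∑ u ∈ T, marginal f u A := by
  induction T using Finset.induction_on with
  | empty => simp
  | insert u T hu ih =>
    rw [Finset.sum_insert hu, Finset.union_insert]
    have h := hf.marginal_anti (u := u) (Finset.subset_union_left (s₁ := A) (s₂ := T))
    unfold marginal at h ⊢
    unfold marginal at ih
    linarith

/-- The marginals along a list of distinct elements, restricted to `S`, telescope. -/
theorem sum_marginal_listedAfter (f : Finset Ω → ℝ) (S : Finset Ω) {l : List Ω} (hl : l.Nodup) :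
    ∑ v ∈ l.toFinset ∩ S, marginal f v (listedAfter v l ∩ S) = f (l.toFinset ∩ S) - f ∅ := by
  induction l with
  | nil => simp
  | cons u l ih =>
    obtain ⟨hu, hl⟩ := List.nodup_cons.1 hl
    have hsum : ∑ v ∈ l.toFinset ∩ S, marginal f v (listedAfter v (u :: l) ∩ S) =
        ∑ v ∈ l.toFinset ∩ S, marginal f v (listedAfter v l ∩ S) := by
      refine Finset.sum_congr rfl fun v hv => ?_
      have hvu : v ≠ u := by
        rintro rfl
        exact hu (List.mem_toFinset.1 (Finset.mem_inter.1 hv).1)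
      rw [listedAfter, if_neg hvu]
    rw [List.toFinset_cons]
    by_cases huS : u ∈ S
    · have hu' : u ∉ l.toFinset ∩ S := by simp [hu]
      rw [Finset.insert_inter_of_mem huS, Finset.sum_insert hu', hsum, ih hl, listedAfter,
        if_pos rfl, marginal]
      ring
    · rw [Finset.insert_inter_of_notMem huS, hsum, ih hl]

end Submodular

/-! ### The geometric potential of a list -/

section Potential

variable {Ω : Type*}

/-- The weighted sum of the values of `g` along a list in which the `j`-th entry (from `j = 0`)
has weight `q ^ (j + 1)`. -/
def geomSum (q : ℝ) (g : Ω → ℝ) : List Ω → ℝ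
  | [] => 0
  | u :: l => q * (g u + geomSum q g l)

variable {q : ℝ} {g h : Ω → ℝ}

theorem geomSum_congr {l : List Ω} (hgh : ∀ v ∈ l, g v = h v) :
    geomSum q g l = geomSum q h l := by
  induction l with
  | nil => rfl
  | cons u l ih => rw [geomSum, geomSum, hgh u (by simp), ih fun v hv => hgh v (by simp [hv])]

theorem geomSum_nonneg (hq : 1 ≤ q) {l : List Ω} (hg : ∀ v ∈ l, 0 ≤ g v) :
    0 ≤ geomSum q g l := by
  induction l with
  | nil => exact le_rfl
  | cons u l ih =>
    have h1 := hg u (by simp)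
    have h2 := ih fun v hv => hg v (by simp [hv])
    rw [geomSum]
    positivity

/-- No entry of a list of length at most n has weight above q^n. -/
theorem geomSum_le_add (hq : 1 ≤ q) {l : List Ω} (hgh : ∀ v ∈ l, g v ≤ h v) {n : ℕ}
    (hn : l.length ≤ n) :
    geomSum q h l ≤ geomSum q g l + q ^ n * ((l.map h).sum - (l.map g).sum) := by
  induction l generalizing n with
  | nil => simp [geomSum]
  | cons u l ih =>
    obtain ⟨n, rfl⟩ : ∃ m, n = m + 1 := ⟨n - 1, by simp at hn; omega⟩
    have h1 := sub_nonneg.2 (hgh u (by simp))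
    have h2 := ih (fun v hv => hgh v (by simp [hv])) (n := n) (by simpa using hn)
    have h3 : q * (h u - g u) ≤ q ^ (n + 1) * (h u - g u) :=
      mul_le_mul_of_nonneg_right (le_self_pow₀ hq (by omega)) h1
    have h4 := mul_le_mul_of_nonneg_left h2 (by linarith : 0 ≤ q)
    simp only [geomSum, List.map_cons, List.sum_cons]
    calc q * (h u + geomSum q h l) = q * g u + q * (h u - g u) + q * geomSum q h l := by ring
      _ ≤ q * g u + q ^ (n + 1) * (h u - g u) +
          q * (geomSum q g l + q ^ n * ((l.map h).sum - (l.map g).sum)) := by linarith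
      _ = _ := by ring

/-- The weights form a geometric series: (q - 1)(q + ... + q^n) = q^(n+1) - q. -/
theorem le_sub_one_mul_geomSum (hq : 1 ≤ q) {m : ℝ} {l : List Ω} (hg : ∀ v ∈ l, m ≤ g v) :
    m * (q ^ (l.length + 1) - q) ≤ (q - 1) * geomSum q g l := by
  induction l with
  | nil => simp [geomSum]
  | cons u l ih =>
    have h1 := hg u (by simp)
    have h2 := ih fun v hv => hg v (by simp [hv])
    have h3 := mul_le_mul_of_nonneg_left h2 (by linarith : 0 ≤ q)
    have h4 := mul_le_mul_of_nonneg_left h1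
      (mul_nonneg (by linarith : 0 ≤ q) (sub_nonneg.2 hq))
    simp only [geomSum, List.length_cons]
    calc m * (q ^ (l.length + 1 + 1) - q)
        = q * (m * (q ^ (l.length + 1) - q)) + q * (q - 1) * m := by ring
      _ ≤ q * ((q - 1) * geomSum q g l) + q * (q - 1) * g u := add_le_add h3 h4
      _ = _ := by ring

/-- Besides the term of v, each entry behind v moves up one place and drops from q^(i+1) to q^i. As
these entries are at least g v, the losses telescope to q^n g v, n being the length, wherever v
stands. -/
theorem geomSum_erase_add_le [DecidableEq Ω] (hq : 1 ≤ q) {l : List Ω} {v : Ω} (hv : v ∈ l)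
    (hg : ∀ x ∈ l, g v ≤ g x) :
    geomSum q g (l.erase v) + q ^ l.length * g v ≤ geomSum q g l := by
  induction l with
  | nil => simp at hv
  | cons u l ih =>
    have hg' : ∀ x ∈ l, g v ≤ g x := fun x hx => hg x (by simp [hx])
    by_cases huv : u = v
    · subst huv
      have h1 := le_sub_one_mul_geomSum hq hg'
      rw [List.erase_cons_head, geomSum, List.length_cons]
      linarith
    · have hv' : v ∈ l := by
        rcases List.mem_cons.1 hv with h | h
        · exact absurd h.symm huv
        · exact h
      have h1 := mul_le_mul_of_nonneg_left (ih hv' hg') (by linarith : 0 ≤ q)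
      rw [List.erase_cons_tail (by simpa using huv), geomSum, geomSum, List.length_cons, pow_succ]
      linarith

end Potential

/-! ### The invariant and its preservation by an exchange -/

section Invariant

variable {Ω : Type*} [DecidableEq Ω] {f : Finset Ω → ℝ}

/-- The list of the elements of `S`, in the order in which they were accepted. -/
def State.kept (s : State Ω) : List Ω := s.accepted.filter (· ∈ s.S)

/-- The quantity `α w_S(S) - w(A)` in the acceptance condition. -/
def State.slack (f : Finset Ω → ℝ) (α : ℝ) (s : State Ω) : ℝ :=
  α * (f s.S - f ∅) - (f s.A - f ∅)

/-- `S` consists of accepted elements, which are distinct. -/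
structure State.WellFormed (s : State Ω) : Prop where
  nodup : s.accepted.Nodup
  subset : s.S ⊆ s.A

theorem State.WellFormed.sum_wS {s : State Ω} (hs : s.WellFormed) (f : Finset Ω → ℝ) :
    ∑ v ∈ s.S, s.wS f v = f s.S - f ∅ := by
  have h := sum_marginal_listedAfter f s.S hs.nodup
  have hA : s.accepted.toFinset ∩ s.S = s.S := Finset.inter_eq_right.2 hs.subset
  rwa [hA] at h

theorem State.WellFormed.sum_w {s : State Ω} (hs : s.WellFormed) (f : Finset Ω → ℝ) :
    ∑ v ∈ s.A, s.w f v = f s.A - f ∅ := by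
  have h := sum_marginal_listedAfter f s.A hs.nodup
  have hA : s.accepted.toFinset ∩ s.A = s.A := Finset.inter_self _
  rw [hA] at h
  rw [← h]
  refine Finset.sum_congr rfl fun v _ => ?_
  have hv : listedAfter v s.accepted ∩ s.A = s.before v :=
    Finset.inter_eq_left.2 (listedAfter_subset v s.accepted)
  rw [hv, State.w]

theorem State.WellFormed.accepts_iff {s : State Ω} (hs : s.WellFormed) (f : Finset Ω → ℝ) (k : ℕ)
    (α : ℝ) (u : Ω) : s.Accepts f k α u ↔ 1 / (k : ℝ) * s.slack f α < marginal f u s.A := by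
  rw [State.Accepts, hs.sum_wS, hs.sum_w, State.slack, gt_iff_lt]

theorem State.WellFormed.kept_nodup {s : State Ω} (hs : s.WellFormed) : s.kept.Nodup :=
  hs.nodup.filter _

theorem State.mem_of_mem_kept {s : State Ω} {v : Ω} (hv : v ∈ s.kept) : v ∈ s.S := by
  simpa using (List.mem_filter.1 hv).2

theorem State.WellFormed.mem_kept {s : State Ω} (hs : s.WellFormed) {v : Ω} :
    v ∈ s.kept ↔ v ∈ s.S :=
  ⟨State.mem_of_mem_kept, fun hv =>
    List.mem_filter.2 ⟨List.mem_toFinset.1 (hs.subset hv), by simpa using hv⟩⟩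

theorem State.WellFormed.kept_toFinset {s : State Ω} (hs : s.WellFormed) :
    s.kept.toFinset = s.S := by
  ext v
  rw [List.mem_toFinset, hs.mem_kept]

theorem State.WellFormed.kept_length {s : State Ω} (hs : s.WellFormed) :
    s.kept.length = s.S.card := by
  rw [← List.toFinset_card_of_nodup hs.kept_nodup, hs.kept_toFinset]

theorem State.WellFormed.kept_sum {s : State Ω} (hs : s.WellFormed) (g : Ω → ℝ) :
    (s.kept.map g).sum = ∑ v ∈ s.S, g v := by
  rw [← List.sum_toFinset g hs.kept_nodup, hs.kept_toFinset]

theorem State.WellFormed.restrict {s : State Ω} (hs : s.WellFormed) {S' : Finset Ω}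
    (hS' : S' ⊆ s.S) : State.WellFormed { S := S', accepted := s.accepted } :=
  ⟨hs.nodup, hS'.trans hs.subset⟩

theorem State.WellFormed.accept {s : State Ω} (hs : s.WellFormed) {u : Ω} (hu : u ∉ s.A) :
    State.WellFormed { S := insert u s.S, accepted := u :: s.accepted } := by
  refine ⟨List.nodup_cons.2 ⟨fun h => hu (List.mem_toFinset.2 h), hs.nodup⟩, ?_⟩
  simpa [State.A] using Finset.insert_subset_insert u hs.subset

theorem State.kept_accept {s : State Ω} {u : Ω} (hu : u ∉ s.A) :
    State.kept { S := insert u s.S, accepted := u :: s.accepted } = u :: s.kept := by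
  have hu' : u ∉ s.accepted := fun h => hu (List.mem_toFinset.2 h)
  simp only [State.kept, List.filter_cons, Finset.mem_insert_self, decide_true, if_true]
  congr 1
  refine List.filter_congr fun v hv => ?_
  have hvu : v ≠ u := fun h => hu' (h ▸ hv)
  simp [hvu]

/-- The set A(v) is fixed once v is accepted, so the later u never enters it. -/
theorem State.wS_accept_of_mem (f : Finset Ω → ℝ) {s : State Ω} {u v : Ω} (hu : u ∉ s.A)
    (hv : v ∈ s.A) :
    State.wS f { S := insert u s.S, accepted := u :: s.accepted } v = s.wS f v := by
  have hvu : v ≠ u := fun h => hu (h ▸ hv)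
  have hu' : u ∉ listedAfter v s.accepted := fun h => hu (listedAfter_subset v s.accepted h)
  simp only [State.wS, State.before, listedAfter, if_neg hvu, Finset.inter_insert_of_notMem hu']

theorem State.WellFormed.wS_accept_self {s : State Ω} (hs : s.WellFormed) (f : Finset Ω → ℝ)
    {u : Ω} (hu : u ∉ s.A) :
    State.wS f { S := insert u s.S, accepted := u :: s.accepted } u = marginal f u s.S := by
  have h : s.accepted.toFinset ∩ s.S = s.S := Finset.inter_eq_right.2 hs.subset
  have hu' : u ∉ s.accepted.toFinset := hu
  simp only [State.wS, State.before, listedAfter, if_true, Finset.inter_insert_of_notMem hu', h]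

/-- What is preserved by an accepting round, with `q = 1 + (α - 2)/(k + 1)`, `α = q ^ (k + 1)`. -/
def State.SlackBound (f : Finset Ω → ℝ) (q : ℝ) (k : ℕ) (s : State Ω) : Prop :=
  geomSum q (s.wS f) s.kept ≤ s.slack f (q ^ (k + 1))

/-- The effect of an accepting round in which `S` is first reduced to `S'`, at a loss of at
most `m`. -/
theorem State.SlackBound.accept (hf : IsMonoSubmodular f) {q : ℝ} {k : ℕ} (hk : 1 ≤ k)
    (hq : 1 < q) (hqk : q ^ (k + 1) - 2 = (k + 1) * (q - 1)) {s : State Ω} (hs : s.WellFormed)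
    (hb : s.SlackBound f q k) (hcard : s.S.card ≤ k) {u : Ω} (hu : u ∉ s.A)
    (hacc : 1 / (k : ℝ) * s.slack f (q ^ (k + 1)) < marginal f u s.A)
    {S' : Finset Ω} (hS' : S' ⊆ s.S) {m : ℝ} (hm : 0 ≤ m)
    (hsum : ∑ v ∈ S', s.wS f v = f s.S - f ∅ - m)
    (hgeom : geomSum q (s.wS f) (State.kept { S := S', accepted := s.accepted }) + q ^ k * m ≤
      geomSum q (s.wS f) s.kept)
    (hmin : m * (q ^ (k + 1) - q) ≤ (q - 1) * geomSum q (s.wS f) s.kept) :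
    State.SlackBound f q k { S := insert u S', accepted := u :: s.accepted } ∧
    s.slack f (q ^ (k + 1)) ≤
      State.slack f (q ^ (k + 1)) { S := insert u S', accepted := u :: s.accepted } ∧
    f s.S < f (insert u S') := by
  set t : State Ω := { S := S', accepted := s.accepted }
  have htw : t.WellFormed := hs.restrict hS'
  have hut : u ∉ t.A := hu
  -- Shrinking S shrinks A(v) ∩ S, so the remaining w_S can only rise.
  have hmono : ∀ v ∈ t.kept, s.wS f v ≤ t.wS f v := fun v _ =>
    hf.marginal_anti (Finset.inter_subset_inter_left hS')
  have hlen : t.kept.length ≤ k := by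
    rw [htw.kept_length]
    exact (Finset.card_le_card hS').trans hcard
  have h1 := geomSum_le_add hq.le hmono hlen
  rw [htw.kept_sum, htw.kept_sum, htw.sum_wS] at h1
  have hD : ∑ v ∈ t.S, s.wS f v ≤ ∑ v ∈ t.S, t.wS f v :=
    Finset.sum_le_sum fun v hv => hmono v (htw.mem_kept.2 hv)
  rw [htw.sum_wS] at hD
  change ∑ v ∈ S', s.wS f v ≤ f S' - f ∅ at hD
  change _ ≤ _ + q ^ k * (f S' - f ∅ - ∑ v ∈ S', s.wS f v) at h1
  rw [hsum] at hD h1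
  have hy : marginal f u s.A ≤ marginal f u S' := hf.marginal_anti (hS'.trans hs.subset)
  have hkept : State.kept { S := insert u S', accepted := u :: s.accepted } = u :: t.kept :=
    State.kept_accept hut
  have hgeom' : geomSum q (State.wS f { S := insert u S', accepted := u :: s.accepted })
      (u :: t.kept) = q * (marginal f u S' + geomSum q (t.wS f) t.kept) := by
    rw [geomSum, geomSum_congr fun v hv => State.wS_accept_of_mem f hut
      (htw.subset (State.mem_of_mem_kept hv))]
    congr 2
    exact htw.wS_accept_self f hut
  have hslack : State.slack f (q ^ (k + 1)) { S := insert u S', accepted := u :: s.accepted } =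
      q ^ (k + 1) * (f S' + marginal f u S' - f ∅) - (f s.A + marginal f u s.A - f ∅) := by
    simp only [State.slack, State.A, marginal, List.toFinset_cons]
    ring
  have hpot0 : 0 ≤ geomSum q (s.wS f) s.kept :=
    geomSum_nonneg hq.le fun v _ => hf.marginal_nonneg _ _
  unfold State.SlackBound at hb ⊢
  rw [hkept, hgeom', hslack]
  have hfS : f (insert u S') = f S' + marginal f u S' := by unfold marginal; ring
  rw [hfS]
  set x := marginal f u s.A
  set y := marginal f u S'
  set θ := s.slack f (q ^ (k + 1))
  set Φ := geomSum q (s.wS f) s.kept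
  set Φ' := geomSum q (s.wS f) t.kept
  set Ψ := geomSum q (t.wS f) t.kept
  have hθ' : θ = q ^ (k + 1) * (f s.S - f ∅) - (f s.A - f ∅) := rfl
  -- D is the total rise of w_S over S' caused by the removal.
  obtain ⟨D, hDdef⟩ : ∃ D, D = f S' - f ∅ - (f s.S - f ∅ - m) := ⟨_, rfl⟩
  have hD0 : 0 ≤ D := by linarith
  rw [← hDdef] at h1
  have hfS' : f S' = f s.S - m + D := by linarith
  rw [hfS']
  have hkpos : (1 : ℝ) ≤ k := by exact_mod_cast hk
  have hkx : θ < k * x := by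
    rw [one_div, inv_mul_lt_iff₀ (by linarith)] at hacc
    exact hacc
  have hpow : q ^ (k + 1) = q * q ^ k := pow_succ' q k
  obtain ⟨α, hα⟩ : ∃ α, α = q ^ (k + 1) := ⟨_, rfl⟩
  rw [← hα] at hqk hmin hθ' ⊢
  -- By the invariant 0 ≤ Φ ≤ θ, and θ < kx.
  have hx : 0 < x := by
    by_contra hneg
    have : (k : ℝ) * x ≤ 0 := mul_nonpos_of_nonneg_of_nonpos (by linarith) (by linarith)
    linarith
  -- The equation for α gives (k + 1)(α - q) = k(α - 1) + 1, so m(α - 1) ≤ (α - 2)x; then α(α - 2) ≤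
  -- (α - 1)^2 finishes.
  have hincr : α * m ≤ (α - 1) * x := by
    have e1 : m * (k * (α - 1) + 1) ≤ (α - 2) * θ := by
      have e2 : (k + 1) * (m * (α - q)) ≤ (k + 1) * ((q - 1) * θ) :=
        mul_le_mul_of_nonneg_left
          (hmin.trans (mul_le_mul_of_nonneg_left hb (by linarith))) (by linarith)
      have e3 : (k + 1) * (m * (α - q)) = m * (k * (α - 1) + 1) := by
        linear_combination m * hqk
      have e4 : (k + 1) * ((q - 1) * θ) = (α - 2) * θ := by
        linear_combination (-θ) * hqk
      linarith
    have hα2 : 0 < α - 2 := by rw [hqk]; exact mul_pos (by linarith) (by linarith)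
    have e5 : (α - 2) * θ ≤ (α - 2) * (k * x) := mul_le_mul_of_nonneg_left hkx.le hα2.le
    have e6 : m * (α - 1) ≤ (α - 2) * x := by
      have : k * (m * (α - 1)) ≤ k * ((α - 2) * x) := by linarith
      exact le_of_mul_le_mul_left this (by linarith)
    have e7 : (α - 2) * (α * m) ≤ (α - 2) * ((α - 1) * x) := by
      have := mul_le_mul_of_nonneg_left e6 (by linarith : 0 ≤ α - 1)
      linarith
    exact le_of_mul_le_mul_left e7 hα2
  have hα2 : 2 < α := by
    have : 0 < α - 2 := by rw [hqk]; exact mul_pos (by linarith) (by linarith)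
    linarith
  have hαy : (α - 1) * x ≤ α * y - x := by
    have := mul_le_mul_of_nonneg_left hy (by linarith : 0 ≤ α)
    linarith
  have hαD : 0 ≤ α * D := mul_nonneg (by linarith) hD0
  refine ⟨?_, ?_, ?_⟩
  -- The terms αm and αD cancel between potential and slack, leaving (q - 1)θ ≤ (α - q)y - x. Since
  -- k(q - 1) = α - 1 - q, this follows from θ < kx and x ≤ y.
  · have g1 : q * Ψ ≤ q * (Φ' + q ^ k * D) := mul_le_mul_of_nonneg_left h1 (by linarith)
    have g2 : q * (Φ' + q ^ k * m) ≤ q * θ := mul_le_mul_of_nonneg_left (by linarith) (by linarith)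
    have g3 : q * (q ^ k * D) = α * D := by rw [hα, hpow]; ring
    have g4 : q * (q ^ k * m) = α * m := by rw [hα, hpow]; ring
    have g5 : k * (q - 1) = α - 1 - q := by linarith
    have g6 : (q - 1) * θ ≤ (α - 1 - q) * x := by
      have := mul_le_mul_of_nonneg_left hkx.le (by linarith : 0 ≤ q - 1)
      rw [← g5]
      linarith
    have hqα : 0 ≤ α - q := by
      have := mul_nonneg (by linarith : (0 : ℝ) ≤ k) (by linarith : 0 ≤ q - 1)
      linarith
    have g7 := mul_le_mul_of_nonneg_left hy hqα
    linarith
  -- The slack changes by α(y - m + D) - x, and αy - x ≥ (α - 1)x ≥ αm.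
  · linarith
  · have : 0 < α * (y - m + D) := by linarith
    have := pos_of_mul_pos_right this (by linarith : 0 ≤ α)
    linarith

end Invariant
-- The constants α_k and α_∞
section Constants

/-- If h b were nonnegative, the slope would be positive on [c, b] and nonpositive on [b, a]. -/
theorem neg_of_convexOn_of_lt_root {h : ℝ → ℝ} {a b c : ℝ} (hh : ConvexOn ℝ (Set.Ici c) h)
    (hc : h c < 0) (ha : h a = 0) (hcb : c < b) (hba : b < a) : h b < 0 := by
  have h1 := hh.slope_mono_adjacent (Set.mem_Ici.2 le_rfl) (Set.mem_Ici.2 (hcb.trans hba).le)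
    hcb hba
  by_contra hb
  have h2 : 0 < (h b - h c) / (b - c) := div_pos (by linarith) (by linarith)
  have h3 : (h a - h b) / (a - b) ≤ 0 :=
    div_nonpos_of_nonpos_of_nonneg (by linarith) (by linarith)
  linarith

/-- The slope on [c, a] is positive, hence so is the slope on [a, b]. -/
theorem pos_of_convexOn_of_root_lt {h : ℝ → ℝ} {a b c : ℝ} (hh : ConvexOn ℝ (Set.Ici c) h)
    (hc : h c < 0) (ha : h a = 0) (hca : c < a) (hab : a < b) : 0 < h b := by
  have h1 := hh.slope_mono_adjacent (Set.mem_Ici.2 le_rfl) (Set.mem_Ici.2 (hca.trans hab).le)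
    hca hab
  have h2 : 0 < (h a - h c) / (a - c) := div_pos (by linarith) (by linarith)
  have h3 := pos_of_mul_pos_left (b := (b - a)⁻¹) (by rw [← div_eq_mul_inv]; linarith)
    (inv_nonneg.2 (by linarith))
  linarith

/-- Bernoulli's inequality with exponent m/n, raised to the power n. -/
theorem one_add_div_pow_lt {x : ℝ} (hx : 0 < x) {n m : ℕ} (hn : 0 < n) (hnm : n < m) :
    (1 + x / n) ^ n < (1 + x / m) ^ m := by
  have hn' : (0 : ℝ) < n := by exact_mod_cast hn
  have hnm' : (n : ℝ) < m := by exact_mod_cast hnm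
  have hm' : (0 : ℝ) < m := hn'.trans hnm'
  have hs : 0 < x / m := div_pos hx hm'
  have h := one_add_mul_self_lt_rpow_one_add (s := x / m) (by linarith) hs.ne'
    (p := (m : ℝ) / n) ((one_lt_div hn').2 hnm')
  have h1 : (m : ℝ) / n * (x / m) = x / n := by field_simp
  rw [h1] at h
  calc (1 + x / n) ^ n < ((1 + x / m) ^ ((m : ℝ) / n)) ^ n :=
        pow_lt_pow_left₀ h (by positivity) hn.ne'
    _ = (1 + x / m) ^ m := by
        rw [← Real.rpow_natCast, ← Real.rpow_mul (by positivity), div_mul_cancel₀ _ hn'.ne',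
          Real.rpow_natCast]

theorem one_add_div_pow_lt_exp {x : ℝ} (hx : 0 < x) {n : ℕ} (hn : 0 < n) :
    (1 + x / n) ^ n < Real.exp x := by
  have hn' : (0 : ℝ) < n := by exact_mod_cast hn
  have h := Real.add_one_lt_exp (div_pos hx hn').ne'
  calc (1 + x / n) ^ n < Real.exp (x / n) ^ n :=
        pow_lt_pow_left₀ (by linarith) (by positivity) hn.ne'
    _ = Real.exp x := by rw [← Real.exp_nat_mul, mul_div_cancel₀ _ hn'.ne']

/-- The function whose root in `(3, 4)` is `α_k`. -/
noncomputable def alphaDefect (k : ℕ) (a : ℝ) : ℝ :=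
  (1 + (a - 2) / ((k : ℝ) + 1)) ^ (k + 1) - a

theorem isAlphaRoot_iff {k : ℕ} {a : ℝ} :
    IsAlphaRoot k a ↔ 3 < a ∧ a < 4 ∧ alphaDefect k a = 0 := by
  rw [IsAlphaRoot, alphaDefect, sub_eq_zero, eq_comm (a := a)]

theorem alphaDefect_lt_alphaDefect {k m : ℕ} (hkm : k < m) {a : ℝ} (ha : 2 < a) :
    alphaDefect k a < alphaDefect m a := by
  have h := one_add_div_pow_lt (sub_pos.2 ha) (Nat.succ_pos k) (Nat.succ_lt_succ hkm)
  push_cast [Nat.succ_eq_add_one] at h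
  exact sub_lt_sub_right h a

theorem alphaDefect_lt_exp (k : ℕ) {a : ℝ} (ha : 2 < a) :
    alphaDefect k a < Real.exp (a - 2) - a := by
  have h := one_add_div_pow_lt_exp (sub_pos.2 ha) (Nat.succ_pos k)
  push_cast [Nat.succ_eq_add_one] at h
  exact sub_lt_sub_right h a

theorem tendsto_alphaDefect (a : ℝ) :
    Filter.Tendsto (fun k => alphaDefect k a) Filter.atTop (nhds (Real.exp (a - 2) - a)) := by
  have h := (Real.tendsto_one_add_div_pow_exp (a - 2)).comp (Filter.tendsto_add_atTop_nat 1)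
  refine (h.sub_const a).congr fun k => ?_
  simp [alphaDefect]

theorem convexOn_alphaDefect (k : ℕ) : ConvexOn ℝ (Set.Ici 3) (alphaDefect k) := by
  have hk : (0 : ℝ) < (k : ℝ) + 1 := by positivity
  refine ⟨convex_Ici _, fun x hx y hy a b ha hb hab => ?_⟩
  have hmem : ∀ z : ℝ, z ∈ Set.Ici (3 : ℝ) → 1 + (z - 2) / ((k : ℝ) + 1) ∈ Set.Ici (0 : ℝ) :=
    fun z hz => by
      have h3 : (3 : ℝ) ≤ z := hz
      have : 0 ≤ (z - 2) / ((k : ℝ) + 1) := div_nonneg (by linarith) hk.le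
      exact Set.mem_Ici.2 (by linarith)
  have h := (convexOn_pow (𝕜 := ℝ) (k + 1)).2 (hmem x hx) (hmem y hy) ha hb hab
  simp only [smul_eq_mul] at h ⊢
  have harg : a * (1 + (x - 2) / ((k : ℝ) + 1)) + b * (1 + (y - 2) / ((k : ℝ) + 1)) =
      1 + (a * x + b * y - 2) / ((k : ℝ) + 1) := by
    field_simp
    linear_combination ((k : ℝ) + 1 - 2) * hab
  rw [harg] at h
  simp only [alphaDefect]
  linarith

/-- (1 + 1/(k+1))^(k+1) < e < 3. -/
theorem alphaDefect_three_neg (k : ℕ) : alphaDefect k 3 < 0 := by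
  have h := alphaDefect_lt_exp k (a := 3) (by norm_num)
  have h1 := Real.exp_one_lt_three
  norm_num at h
  linarith

theorem alphaDefect_four_pos {k : ℕ} (hk : 2 ≤ k) : 0 < alphaDefect k 4 := by
  -- (5/3)^3 = 125/27 > 4. For k = 1 the defect at 4 is exactly 0.
  have h2 : 0 < alphaDefect 2 4 := by norm_num [alphaDefect]
  rcases hk.eq_or_lt with rfl | h
  · exact h2
  · exact h2.trans (alphaDefect_lt_alphaDefect h (by norm_num))

theorem exists_isAlphaRoot {k : ℕ} (hk : 2 ≤ k) : ∃ a, IsAlphaRoot k a := by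
  have hcont : ContinuousOn (alphaDefect k) (Set.Icc 3 4) := by
    unfold alphaDefect
    fun_prop
  obtain ⟨a, ⟨h3, h4⟩, ha⟩ := intermediate_value_Ioo (by norm_num : (3 : ℝ) ≤ 4) hcont
    ⟨alphaDefect_three_neg k, alphaDefect_four_pos hk⟩
  exact ⟨a, isAlphaRoot_iff.2 ⟨h3, h4, ha⟩⟩

theorem IsAlphaRoot.unique {k : ℕ} {a b : ℝ} (ha : IsAlphaRoot k a) (hb : IsAlphaRoot k b) :
    a = b := by
  obtain ⟨ha3, -, ha0⟩ := isAlphaRoot_iff.1 ha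
  obtain ⟨hb3, -, hb0⟩ := isAlphaRoot_iff.1 hb
  have hc := convexOn_alphaDefect k
  rcases lt_trichotomy a b with h | h | h
  · exact absurd hb0 (pos_of_convexOn_of_root_lt hc (alphaDefect_three_neg k) ha0 ha3 h).ne'
  · exact h
  · exact absurd ha0 (pos_of_convexOn_of_root_lt hc (alphaDefect_three_neg k) hb0 hb3 h).ne'

theorem isAlphaRoot_iff_eq {k : ℕ} (hk : 2 ≤ k) (a : ℝ) : IsAlphaRoot k a ↔ a = alphaK k := by
  obtain ⟨b, hb⟩ := exists_isAlphaRoot hk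
  have hset : {a : ℝ | IsAlphaRoot k a} = {b} := by
    ext a
    exact ⟨fun ha => IsAlphaRoot.unique ha hb,
      fun ha => by rw [Set.mem_singleton_iff.1 ha]; exact hb⟩
  rw [alphaK, hset, csSup_singleton]
  exact ⟨fun ha => IsAlphaRoot.unique ha hb, fun ha => ha ▸ hb⟩

theorem isAlphaRoot_alphaK {k : ℕ} (hk : 2 ≤ k) : IsAlphaRoot k (alphaK k) :=
  (isAlphaRoot_iff_eq hk _).2 rfl

theorem alphaK_lt_of_alphaDefect_pos {k : ℕ} (hk : 2 ≤ k) {b : ℝ} (hb : 3 < b)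
    (h : 0 < alphaDefect k b) : alphaK k < b := by
  obtain ⟨h3, -, h0⟩ := isAlphaRoot_iff.1 (isAlphaRoot_alphaK hk)
  rcases lt_trichotomy b (alphaK k) with h1 | h1 | h1
  · exact absurd h (neg_of_convexOn_of_lt_root (convexOn_alphaDefect k) (alphaDefect_three_neg k)
      h0 hb h1).not_gt
  · rw [h1] at h
    exact absurd h0 h.ne'
  · exact h1

theorem lt_alphaK_of_alphaDefect_neg {k : ℕ} (hk : 2 ≤ k) {b : ℝ}
    (h : alphaDefect k b < 0) : b < alphaK k := by
  obtain ⟨h3, -, h0⟩ := isAlphaRoot_iff.1 (isAlphaRoot_alphaK hk)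
  rcases lt_trichotomy b (alphaK k) with h1 | h1 | h1
  · exact h1
  · rw [h1] at h
    exact absurd h0 h.ne
  · exact absurd h (pos_of_convexOn_of_root_lt (convexOn_alphaDefect k) (alphaDefect_three_neg k)
      h0 h3 h1).not_gt

theorem strictAntiOn_alphaK : StrictAntiOn alphaK (Set.Ici 2) := by
  intro k hk m hm hkm
  obtain ⟨h3, -, h0⟩ := isAlphaRoot_iff.1 (isAlphaRoot_alphaK hk)
  refine alphaK_lt_of_alphaDefect_pos hm h3 ?_
  have h := alphaDefect_lt_alphaDefect hkm (a := alphaK k) (by linarith)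
  linarith

/-- The bound is chosen so that 0.2959 · 3.3795 < 1. -/
theorem alphaK_four_lt : alphaK 4 < 3.3795 :=
  alphaK_lt_of_alphaDefect_pos (by norm_num) (by norm_num) (by norm_num [alphaDefect])

theorem convexOn_exp_sub : ConvexOn ℝ (Set.Ici 1) fun a => Real.exp (a - 2) - a := by
  refine ⟨convex_Ici _, fun x _ y _ a b ha hb hab => ?_⟩
  have h := convexOn_exp.2 (Set.mem_univ (x - 2)) (Set.mem_univ (y - 2)) ha hb hab
  simp only [smul_eq_mul] at h ⊢
  have harg : a * (x - 2) + b * (y - 2) = a * x + b * y - 2 := by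
    linear_combination (-2) * hab
  rw [harg] at h
  linarith

theorem exp_sub_one_neg : Real.exp ((1 : ℝ) - 2) - 1 < 0 := by
  have h : Real.exp ((1 : ℝ) - 2) < 1 := by
    rw [Real.exp_lt_one_iff]; norm_num
  linarith

theorem exp_sub_lower_neg : Real.exp ((3.146185 : ℝ) - 2) - 3.146185 < 0 := by
  have h1 := Real.exp_one_lt_d9
  have h2 := Real.exp_bound' (x := 0.146185) (by norm_num) (by norm_num) (n := 7) (by norm_num)
  norm_num [Finset.sum_range_succ, Nat.factorial] at h2
  -- Splitting off a factor e leaves a small exponent, for which seven Taylor terms suffice.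
  have h3 : ((3.146185 : ℝ) - 2) = 1 + 29237 / 200000 := by norm_num
  rw [h3, Real.exp_add]
  have h4 := mul_le_mul h1.le h2 (Real.exp_pos _).le (by norm_num)
  norm_num at h4 ⊢
  linarith

theorem exp_sub_upper_pos : 0 < Real.exp ((3.146195 : ℝ) - 2) - 3.146195 := by
  have h1 := Real.exp_one_gt_d9
  have h2 := Real.sum_le_exp_of_nonneg (x := 0.146195) (by norm_num) 7
  norm_num [Finset.sum_range_succ, Nat.factorial] at h2
  have h3 : ((3.146195 : ℝ) - 2) = 1 + 29239 / 200000 := by norm_num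
  rw [h3, Real.exp_add]
  have h4 := mul_le_mul h1.le h2 (by norm_num) (Real.exp_pos _).le
  norm_num at h4 ⊢
  linarith

theorem exists_isAlphaInfRoot : ∃ a : ℝ, 3.146185 < a ∧ a < 3.146195 ∧ IsAlphaInfRoot a := by
  have hcont : ContinuousOn (fun a : ℝ => Real.exp (a - 2) - a) (Set.Icc 3.146185 3.146195) := by
    fun_prop
  obtain ⟨a, ⟨h3, h4⟩, ha⟩ := intermediate_value_Ioo (by norm_num) hcont
    ⟨exp_sub_lower_neg, exp_sub_upper_pos⟩
  exact ⟨a, h3, h4, by linarith, (sub_eq_zero.1 ha).symm⟩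

theorem IsAlphaInfRoot.unique {a b : ℝ} (ha : IsAlphaInfRoot a) (hb : IsAlphaInfRoot b) :
    a = b := by
  have ha0 : Real.exp (a - 2) - a = 0 := sub_eq_zero.2 ha.2.symm
  have hb0 : Real.exp (b - 2) - b = 0 := sub_eq_zero.2 hb.2.symm
  rcases lt_trichotomy a b with h | h | h
  · exact absurd hb0 (pos_of_convexOn_of_root_lt convexOn_exp_sub exp_sub_one_neg ha0 ha.1 h).ne'
  · exact h
  · exact absurd ha0 (pos_of_convexOn_of_root_lt convexOn_exp_sub exp_sub_one_neg hb0 hb.1 h).ne'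

theorem isAlphaInfRoot_iff_eq (a : ℝ) : IsAlphaInfRoot a ↔ a = alphaInf := by
  obtain ⟨b, -, -, hb⟩ := exists_isAlphaInfRoot
  have hset : {a : ℝ | IsAlphaInfRoot a} = {b} := by
    ext a
    exact ⟨fun ha => ha.unique hb, fun ha => by rw [Set.mem_singleton_iff.1 ha]; exact hb⟩
  rw [alphaInf, hset, csSup_singleton]
  exact ⟨fun ha => ha.unique hb, fun ha => ha ▸ hb⟩

theorem isAlphaInfRoot_alphaInf : IsAlphaInfRoot alphaInf :=
  (isAlphaInfRoot_iff_eq _).2 rfl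

theorem alphaInf_mem_Ioo : alphaInf ∈ Set.Ioo (3.146185 : ℝ) 3.146195 := by
  obtain ⟨b, h1, h2, hb⟩ := exists_isAlphaInfRoot
  rw [← (isAlphaInfRoot_iff_eq b).1 hb]
  exact ⟨h1, h2⟩

theorem tendsto_alphaK : Filter.Tendsto alphaK Filter.atTop (nhds alphaInf) := by
  have hmem := alphaInf_mem_Ioo.1
  have h0 : Real.exp (alphaInf - 2) - alphaInf = 0 := sub_eq_zero.2 isAlphaInfRoot_alphaInf.2.symm
  refine tendsto_order.2 ⟨fun b hb => ?_, fun b hb => ?_⟩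
  -- The defect lies below its limit exp(a - 2) - a, so it is negative at α_∞ and α_∞ < α_k.
  -- Conversely, at any b > α_∞ the limit is positive, so the defect is eventually positive there.
  · filter_upwards [Filter.eventually_ge_atTop 2] with k hk
    refine hb.trans (lt_alphaK_of_alphaDefect_neg hk ?_)
    rw [← h0]
    exact alphaDefect_lt_exp k (by linarith)
  · have hpos := pos_of_convexOn_of_root_lt convexOn_exp_sub exp_sub_one_neg h0
      isAlphaInfRoot_alphaInf.1 hb
    filter_upwards [Filter.eventually_ge_atTop 2,
      (tendsto_alphaDefect b).eventually_const_lt hpos] with k hk h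
    exact alphaK_lt_of_alphaDefect_pos hk (by linarith) h

end Constants
-- Analysis of the threshold algorithm
section ThresholdAlgorithm

variable {Ω : Type*} [DecidableEq Ω] {f : Finset Ω → ℝ}

theorem State.WellFormed.kept_erase {s : State Ω} (hs : s.WellFormed) (v : Ω) :
    State.kept { S := s.S.erase v, accepted := s.accepted } = s.kept.erase v := by
  rw [hs.kept_nodup.erase_eq_filter, State.kept, State.kept, List.filter_filter]
  refine List.filter_congr fun x _ => ?_
  by_cases h : x = v <;> simp [h]

/-- The effect of an accepting round. -/
theorem State.step_of_accepts (hf : IsMonoSubmodular f) {q : ℝ} {k : ℕ} (hk : 1 ≤ k)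
    (hq : 1 < q) (hqk : q ^ (k + 1) - 2 = (k + 1) * (q - 1)) (tb : TieBreak Ω) {u : Ω}
    (l : List Ω) {s : State Ω} (hs : s.WellFormed) (hb : s.SlackBound f q k)
    (hcard : s.S.card ≤ k) (hu : u ∉ s.A) (hacc : s.Accepts f k (q ^ (k + 1)) u) :
    (s.step f k (q ^ (k + 1)) tb u l).WellFormed ∧
    (s.step f k (q ^ (k + 1)) tb u l).SlackBound f q k ∧
    s.slack f (q ^ (k + 1)) ≤ (s.step f k (q ^ (k + 1)) tb u l).slack f (q ^ (k + 1)) ∧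
    f s.S < f (s.step f k (q ^ (k + 1)) tb u l).S ∧
    (s.step f k (q ^ (k + 1)) tb u l).A = insert u s.A := by
  have hacc' := (hs.accepts_iff f k _ u).1 hacc
  have hwS : ∀ v, 0 ≤ s.wS f v := fun v => hf.marginal_nonneg _ _
  have hA : ∀ S' : Finset Ω, State.A { S := S', accepted := u :: s.accepted } = insert u s.A :=
    fun S' => by simp [State.A]
  unfold State.step
  rw [if_pos hacc]
  split_ifs with hfull
  · have hne : (s.minimizers f).Nonempty :=
      s.minimizers_nonempty f (Finset.card_pos.1 (by omega))
    have hpick : ∃ v ∈ s.minimizers f,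
        removePicked tb (u :: l) (s.minimizers f) s.S = s.S.erase v :=
      ⟨_, (tb (u :: l) _ hne).2, by rw [removePicked, dif_pos hne]⟩
    obtain ⟨v, hv, hrem⟩ := hpick
    rw [hrem]
    obtain ⟨hvS, hvmin⟩ := Finset.mem_filter.1 hv
    have hmin : ∀ x ∈ s.kept, s.wS f v ≤ s.wS f x := fun x hx =>
      hvmin x (State.mem_of_mem_kept hx)
    have hlen : s.kept.length = k := hs.kept_length.trans hfull
    have hge := le_sub_one_mul_geomSum hq.le hmin
    have herase := geomSum_erase_add_le hq.le (hs.mem_kept.2 hvS) hmin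
    rw [hlen] at hge herase
    have hsum : ∑ x ∈ s.S.erase v, s.wS f x = f s.S - f ∅ - s.wS f v := by
      rw [← hs.sum_wS f, ← Finset.sum_erase_add _ _ hvS]
      ring
    have h := State.SlackBound.accept hf hk hq hqk hs hb hcard hu hacc'
      (Finset.erase_subset v s.S) (hwS v) hsum (by rw [hs.kept_erase]; exact herase) hge
    exact ⟨(hs.restrict (Finset.erase_subset v s.S)).accept hu, h.1, h.2.1, h.2.2, hA _⟩
  -- S is not full: nothing is removed and m = 0.
  · have h := State.SlackBound.accept hf hk hq hqk hs hb hcard hu hacc'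
      (Finset.Subset.refl s.S) le_rfl (by rw [hs.sum_wS f, sub_zero])
      (by rw [mul_zero, add_zero])
      (by
        rw [zero_mul]
        exact mul_nonneg (by linarith) (geomSum_nonneg hq.le fun v _ => hwS v))
    exact ⟨hs.accept hu, h.1, h.2.1, h.2.2, hA _⟩

theorem State.SlackBound.slack_nonneg (hf : IsMonoSubmodular f) {q : ℝ} (hq : 1 ≤ q) {k : ℕ}
    {s : State Ω} (hb : s.SlackBound f q k) : 0 ≤ s.slack f (q ^ (k + 1)) :=
  (geomSum_nonneg hq fun _ _ => hf.marginal_nonneg _ _).trans hb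

theorem thresholdRun_invariant (hf : IsMonoSubmodular f) {q : ℝ} {k : ℕ} (hk : 1 ≤ k)
    (hq : 1 < q) (hqk : q ^ (k + 1) - 2 = (k + 1) * (q - 1)) (tb : TieBreak Ω) {l : List Ω}
    (hl : l.Nodup) :
    (thresholdRun f k (q ^ (k + 1)) tb l).WellFormed ∧
    (thresholdRun f k (q ^ (k + 1)) tb l).SlackBound f q k ∧
    ∀ u ∈ l, u ∉ (thresholdRun f k (q ^ (k + 1)) tb l).A →
      marginal f u (thresholdRun f k (q ^ (k + 1)) tb l).A ≤
        1 / (k : ℝ) * (thresholdRun f k (q ^ (k + 1)) tb l).slack f (q ^ (k + 1)) := by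
  induction l with
  | nil =>
    refine ⟨⟨List.nodup_nil, Finset.empty_subset _⟩, ?_, by simp⟩
    simp [State.SlackBound, State.kept, State.slack, State.A, geomSum, thresholdRun]
  | cons u l ih =>
    obtain ⟨hu, hl⟩ := List.nodup_cons.1 hl
    obtain ⟨hs, hb, hrej⟩ := ih hl
    have hcard := thresholdRun_card f k hk (q ^ (k + 1)) tb l
    have huA : u ∉ (thresholdRun f k (q ^ (k + 1)) tb l).A := fun h =>
      hu (List.mem_toFinset.1 ((thresholdRun_subset f k (q ^ (k + 1)) tb l).2 h))
    rw [thresholdRun]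
    generalize thresholdRun f k (q ^ (k + 1)) tb l = s at *
    by_cases hacc : s.Accepts f k (q ^ (k + 1)) u
    · obtain ⟨h1, h2, h3, -, h5⟩ :=
        State.step_of_accepts hf hk hq hqk tb l hs hb hcard huA hacc
      refine ⟨h1, h2, fun v hv hvA => ?_⟩
      rw [h5] at hvA ⊢
      have hvu : v ≠ u := fun h => hvA (h ▸ Finset.mem_insert_self _ _)
      have hvl : v ∈ l := (List.mem_cons.1 hv).resolve_left hvu
      -- An earlier rejection stays justified: the marginal falls and the slack rises.
      calc marginal f v (insert u s.A) ≤ marginal f v s.A :=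
            hf.marginal_anti (Finset.subset_insert _ _)
        _ ≤ 1 / (k : ℝ) * s.slack f (q ^ (k + 1)) :=
            hrej v hvl fun h => hvA (Finset.mem_insert_of_mem h)
        _ ≤ _ := mul_le_mul_of_nonneg_left h3 (by positivity)
    · have hstep : s.step f k (q ^ (k + 1)) tb u l = s := by rw [State.step, if_neg hacc]
      rw [hstep]
      refine ⟨hs, hb, fun v hv hvA => ?_⟩
      rcases List.mem_cons.1 hv with rfl | hvl
      · exact not_lt.1 fun h => hacc ((hs.accepts_iff f k _ _).2 h)
      · exact hrej v hvl hvA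

theorem thresholdRun_strictlyMonotone (hf : IsMonoSubmodular f) {q : ℝ} {k : ℕ} (hk : 1 ≤ k)
    (hq : 1 < q) (hqk : q ^ (k + 1) - 2 = (k + 1) * (q - 1)) (tb : TieBreak Ω) {u : Ω}
    {l : List Ω} (hl : (u :: l).Nodup)
    (hu : u ∈ (thresholdRun f k (q ^ (k + 1)) tb (u :: l)).S) :
    f (thresholdRun f k (q ^ (k + 1)) tb l).S <
      f (thresholdRun f k (q ^ (k + 1)) tb (u :: l)).S := by
  obtain ⟨hul, hl⟩ := List.nodup_cons.1 hl
  obtain ⟨hs, hb, -⟩ := thresholdRun_invariant hf hk hq hqk tb hl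
  have hcard := thresholdRun_card f k hk (q ^ (k + 1)) tb l
  have hsub := thresholdRun_subset f k (q ^ (k + 1)) tb l
  rw [thresholdRun] at hu ⊢
  generalize thresholdRun f k (q ^ (k + 1)) tb l = s at *
  have huA : u ∉ s.A := fun h => hul (List.mem_toFinset.1 (hsub.2 h))
  by_cases hacc : s.Accepts f k (q ^ (k + 1)) u
  · exact (State.step_of_accepts hf hk hq hqk tb l hs hb hcard huA hacc).2.2.2.1
  · rw [State.step, if_neg hacc] at hu
    exact absurd (List.mem_toFinset.1 (hsub.1 hu)) hul

theorem thresholdRun_competitive (hf : IsMonoSubmodular f) {q : ℝ} {k : ℕ} (hk : 1 ≤ k)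
    (hq : 1 < q) (hqk : q ^ (k + 1) - 2 = (k + 1) * (q - 1)) (tb : TieBreak Ω) {l : List Ω}
    (hl : l.Nodup) {T : Finset Ω} (hT : T ⊆ l.toFinset) (hTk : T.card ≤ k) :
    f T ≤ q ^ (k + 1) * f (thresholdRun f k (q ^ (k + 1)) tb l).S := by
  obtain ⟨-, hb, hrej⟩ := thresholdRun_invariant hf hk hq hqk tb hl
  generalize thresholdRun f k (q ^ (k + 1)) tb l = s at *
  have h0 := hb.slack_nonneg hf hq.le
  have hkpos : (0 : ℝ) < k := by exact_mod_cast hk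
  have hmarg : ∀ u ∈ T, marginal f u s.A ≤ 1 / (k : ℝ) * s.slack f (q ^ (k + 1)) := by
    intro u hu
    -- Accepted elements have marginal 0, so here nonnegativity of the slack is what is needed.
    by_cases huA : u ∈ s.A
    · rw [marginal, Finset.insert_eq_of_mem huA, sub_self]
      positivity
    · exact hrej u (List.mem_toFinset.1 (hT hu)) huA
  have h1 := Finset.sum_le_card_nsmul T _ _ hmarg
  rw [nsmul_eq_mul] at h1
  have h2 : (T.card : ℝ) * (1 / (k : ℝ) * s.slack f (q ^ (k + 1))) ≤
      k * (1 / (k : ℝ) * s.slack f (q ^ (k + 1))) :=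
    mul_le_mul_of_nonneg_right (by exact_mod_cast hTk) (by positivity)
  have h3 : (k : ℝ) * (1 / (k : ℝ) * s.slack f (q ^ (k + 1))) = s.slack f (q ^ (k + 1)) := by
    field_simp
  have h4 := hf.union_le_add_sum_marginal s.A T
  have h5 := hf.mono T (s.A ∪ T) Finset.subset_union_right
  have h6 : s.slack f (q ^ (k + 1)) = q ^ (k + 1) * (f s.S - f ∅) - (f s.A - f ∅) := rfl
  have h7 : f ∅ ≤ q ^ (k + 1) * f ∅ :=
    le_mul_of_one_le_left (hf.nonneg ∅) (one_le_pow₀ hq.le)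
  linarith

/-- Supplies the two identities that are all the exchange argument uses about α_k. -/
theorem exists_base_alphaK {k : ℕ} (hk : 2 ≤ k) :
    ∃ q : ℝ, 1 < q ∧ alphaK k = q ^ (k + 1) ∧ q ^ (k + 1) - 2 = (k + 1) * (q - 1) := by
  obtain ⟨h3, -, h⟩ := isAlphaRoot_alphaK hk
  have hk' : (0 : ℝ) < (k : ℝ) + 1 := by positivity
  refine ⟨1 + (alphaK k - 2) / ((k : ℝ) + 1), ?_, h, ?_⟩
  · have : 0 < (alphaK k - 2) / ((k : ℝ) + 1) := div_pos (by linarith) hk'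
    linarith
  · rw [← h]
    field_simp
    ring

theorem thresholdAlg_isStrictlyMonotone (tb : TieBreak Ω) {k : ℕ} (hk : 4 ≤ k) :
    (thresholdAlg k hk tb).IsStrictlyMonotone := by
  obtain ⟨q, hq, hα, hqk⟩ := exists_base_alphaK (k := k) (by omega)
  intro f hf u l hl hu
  simp only [thresholdAlg, hα] at hu ⊢
  exact thresholdRun_strictlyMonotone hf (by omega) hq hqk tb hl hu

theorem thresholdAlg_isCompetitive (tb : TieBreak Ω) {k : ℕ} (hk : 4 ≤ k) :
    (thresholdAlg k hk tb).IsCompetitive (1 / alphaK k) := by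
  obtain ⟨q, hq, hα, hqk⟩ := exists_base_alphaK (k := k) (by omega)
  intro f hf l hl T hT
  have h := thresholdRun_competitive hf (by omega) hq hqk tb hl hT.1 hT.2.1
  simp only [thresholdAlg, hα]
  rw [one_div, inv_mul_le_iff₀ (pow_pos (by linarith) _)]
  exact h

end ThresholdAlgorithm

/-! ### The best singleton -/

section SingletonAlgorithm

variable {Ω : Type*}

theorem le_singletonRun (f : Finset Ω → ℝ) {l : List Ω} {u : Ω} (hu : u ∈ l) :
    f {u} ≤ f (singletonRun f l) := by
  induction l with
  | nil => simp at hu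
  | cons v l ih =>
    rw [singletonRun]
    rcases List.mem_cons.1 hu with rfl | h
    · split_ifs with hlt
      · exact le_rfl
      · exact not_lt.1 hlt
    · split_ifs with hlt
      · exact (ih h).trans hlt.le
      · exact ih h

theorem singletonAlg_isCompetitive [DecidableEq Ω] {k : ℕ} (hk : 1 ≤ k) :
    (singletonAlg (Ω := Ω) k hk).IsCompetitive (1 / (k : ℝ)) := by
  intro f hf l _ T hT
  change 1 / (k : ℝ) * f T ≤ f (singletonRun f l)
  have hk' : (1 : ℝ) ≤ k := by exact_mod_cast hk
  have h0 : f ∅ ≤ f (singletonRun f l) := hf.mono _ _ (Finset.empty_subset _)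
  -- Each element of T adds at most f(S) - f(∅) to f(∅), so f(T) ≤ f(∅) + k(f(S) - f(∅)) ≤ k f(S).
  have h1 : ∑ u ∈ T, marginal f u ∅ ≤ T.card • (f (singletonRun f l) - f ∅) := by
    refine Finset.sum_le_card_nsmul T _ _ fun u hu => ?_
    have := le_singletonRun f (List.mem_toFinset.1 (hT.1 hu))
    simp only [marginal, insert_empty_eq]
    linarith
  rw [nsmul_eq_mul] at h1
  have h2 : (T.card : ℝ) * (f (singletonRun f l) - f ∅) ≤ k * (f (singletonRun f l) - f ∅) :=
    mul_le_mul_of_nonneg_right (by exact_mod_cast hT.2.1) (by linarith)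
  have h3 := hf.union_le_add_sum_marginal ∅ T
  rw [Finset.empty_union] at h3
  have h4 : f ∅ ≤ k * f ∅ := le_mul_of_one_le_left (hf.nonneg ∅) hk'
  rw [one_div, inv_mul_le_iff₀ (by linarith)]
  linarith

end SingletonAlgorithm

/-! ### Combining the two algorithms -/

section Combined

variable {Ω : Type*} [DecidableEq Ω]

theorem OnlineAlgorithm.IsCompetitive.mono {I : Finset Ω → Prop} {alg : OnlineAlgorithm Ω I}
    {r r' : ℝ} (h : alg.IsCompetitive r) (hr : r' ≤ r) : alg.IsCompetitive r' :=
  fun f hf l hl T hT =>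
    (mul_le_mul_of_nonneg_right hr (hf.nonneg T)).trans (h f hf l hl T hT)

/-- For 2 ≤ k ≤ 3 this is k ≤ 3 < α_k. -/
theorem uniformRatio_of_le_three {k : ℕ} (hk : 1 ≤ k) (hk3 : k ≤ 3) :
    uniformRatio k = 1 / (k : ℝ) := by
  unfold uniformRatio
  split_ifs with h1
  · simp [h1]
  · have h3 := (isAlphaRoot_alphaK (k := k) (by omega)).1
    have hk' : (k : ℝ) ≤ 3 := by exact_mod_cast hk3
    exact max_eq_left (one_div_le_one_div_of_le (by positivity) (by linarith))

/-- α_k < 4 ≤ k. -/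
theorem uniformRatio_of_four_le {k : ℕ} (hk : 4 ≤ k) : uniformRatio k = 1 / alphaK k := by
  obtain ⟨h3, h4, -⟩ := isAlphaRoot_alphaK (k := k) (by omega)
  have hk' : (4 : ℝ) ≤ k := by exact_mod_cast hk
  rw [uniformRatio, if_neg (by omega)]
  exact max_eq_right (one_div_le_one_div_of_le (by linarith) (by linarith))

theorem one_div_alphaK_four_le_uniformRatio {k : ℕ} (hk : 1 ≤ k) :
    1 / alphaK 4 ≤ uniformRatio k := by
  have h3 := (isAlphaRoot_alphaK (k := 4) (by norm_num)).1
  rcases Nat.lt_or_ge 3 k with h | h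
  · rw [uniformRatio_of_four_le h]
    have hk3 := (isAlphaRoot_alphaK (k := k) (by omega)).1
    exact one_div_le_one_div_of_le (by linarith)
      (strictAntiOn_alphaK.antitoneOn (Set.mem_Ici.2 (by norm_num))
        (Set.mem_Ici.2 (by omega)) h)
  · rw [uniformRatio_of_le_three hk h]
    have hk' : (k : ℝ) ≤ 3 := by exact_mod_cast h
    exact one_div_le_one_div_of_le (by exact_mod_cast hk) (by linarith)

theorem combinedAlg_isCompetitive {k : ℕ} (hk : 1 ≤ k) (tb : TieBreak Ω) :
    (combinedAlg k hk tb).IsCompetitive (uniformRatio k) := by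
  unfold combinedAlg
  split_ifs with h
  · rw [uniformRatio_of_four_le h]
    exact thresholdAlg_isCompetitive tb h
  · rw [uniformRatio_of_le_three hk (by omega)]
    exact singletonAlg_isCompetitive hk

end Combined

end OnlineSubmod

theorem mainTheorem1 :
    -- the constants `α_k` and `α_∞`
    (∀ k : ℕ, 2 ≤ k → ∀ a : ℝ, OnlineSubmod.IsAlphaRoot k a ↔ a = OnlineSubmod.alphaK k) ∧
    (∀ a : ℝ, OnlineSubmod.IsAlphaInfRoot a ↔ a = OnlineSubmod.alphaInf) ∧
    StrictAntiOn OnlineSubmod.alphaK (Set.Ici 2) ∧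
    Filter.Tendsto OnlineSubmod.alphaK Filter.atTop (nhds OnlineSubmod.alphaInf) ∧
    |OnlineSubmod.alphaInf - 3.14619| < 0.000005 ∧
    -- the threshold algorithm, for every way of breaking ties
    (∀ (Ω : Type*) [DecidableEq Ω] (tb : OnlineSubmod.TieBreak Ω) (k : ℕ) (hk : 4 ≤ k),
      (OnlineSubmod.thresholdAlg k hk tb).IsStrictlyMonotone ∧
      (OnlineSubmod.thresholdAlg k hk tb).IsCompetitive (1 / OnlineSubmod.alphaK k)) ∧
    -- the best singleton, and the combination of the two algorithms
    (∀ (Ω : Type*) [DecidableEq Ω] (k : ℕ) (hk : 1 ≤ k),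
      (OnlineSubmod.singletonAlg (Ω := Ω) k hk).IsCompetitive (1 / (k : ℝ)) ∧
      (∀ tb : OnlineSubmod.TieBreak Ω,
        (OnlineSubmod.combinedAlg k hk tb).IsCompetitive (OnlineSubmod.uniformRatio k)) ∧
      ∃ alg : OnlineSubmod.OnlineAlgorithm Ω (OnlineSubmod.UniformIndep Ω k),
        alg.IsCompetitive (1 / OnlineSubmod.alphaK 4)) ∧
    IsLeast {r : ℝ | ∃ k : ℕ, 1 ≤ k ∧ r = OnlineSubmod.uniformRatio k}
      (1 / OnlineSubmod.alphaK 4) ∧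
    0.2959 < 1 / OnlineSubmod.alphaK 4 := by

  refine ⟨fun k hk => OnlineSubmod.isAlphaRoot_iff_eq hk, OnlineSubmod.isAlphaInfRoot_iff_eq,
    OnlineSubmod.strictAntiOn_alphaK, OnlineSubmod.tendsto_alphaK, ?_,
    fun Ω _ tb k hk => ⟨OnlineSubmod.thresholdAlg_isStrictlyMonotone tb hk,
      OnlineSubmod.thresholdAlg_isCompetitive tb hk⟩,
    fun Ω _ k hk => ⟨OnlineSubmod.singletonAlg_isCompetitive hk,
      OnlineSubmod.combinedAlg_isCompetitive hk,
      -- Any tie-breaking rule will do; this one chooses an arbitrary minimizer.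
      OnlineSubmod.combinedAlg k hk fun _ _ hM => ⟨hM.choose, hM.choose_spec⟩,
      (OnlineSubmod.combinedAlg_isCompetitive hk _).mono
        (OnlineSubmod.one_div_alphaK_four_le_uniformRatio hk)⟩,
    ⟨⟨4, by norm_num, (OnlineSubmod.uniformRatio_of_four_le le_rfl).symm⟩, ?_⟩, ?_⟩
  · obtain ⟨h1, h2⟩ := OnlineSubmod.alphaInf_mem_Ioo
    rw [abs_lt]
    constructor <;> linarith
  · rintro _ ⟨k, hk, rfl⟩
    exact OnlineSubmod.one_div_alphaK_four_le_uniformRatio hk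
  · have h3 := (OnlineSubmod.isAlphaRoot_alphaK (k := 4) (by norm_num)).1
    have h4 := OnlineSubmod.alphaK_four_lt
    rw [lt_div_iff₀ (by linarith)]
    linarith
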